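/- Let $\mathbb K$ be a field of characteristic $0$ and let $n,d$ be integers with $2<d<n/2$. Let $\vec C_n^S$ be the circulant digraph with connection set $S=\{1,2,\dots,d\}\subset\mathbb Z/n\mathbb Z$, i.e. the digraph with vertex set $V=\mathbb Z/n\mathbb Z$ and an arrow $a\to a+s$ for every $a\in V$ and $s\in S$. For $m\ge 0$ let $\Lambda_m$ be the $\mathbb K$-vector space with basis the sequences $e_{v_0\dots v_m}$ of elements of $V$, with boundary $\partial e_{v_0\dots v_m}=\sum_{j=0}^m(-1)^j e_{v_0\dots\widehat{v_j}\dots v_m}$ for $m\ge1$ and $\partial=0$ on $\Lambda_0$. Let $R_m$ be the quotient of $\Lambda_m$ by the span of all $e_{v_0\dots v_m}$ with $v_{k-1}=v_k$ for some $k$, with the induced boundary; let $A_m\subseteq R_m$ be the span of all $e_{v_0\dots v_m}$ such that $v_{k-1}\to v_k$ is an arrow for each $k=1,\dots,m$; and let $\Omega_0=A_0$, $\Omega_m=\{u\in A_m:\partial u\in A_{m-1}\}$ for $m\ge1$. The path homology $H_m^{\mathrm{path}}(\vec C_n^S;\mathbb K)$ is the homology in degree $m$ of the chain complex $(\Omega_*,\partial)$.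 Then \[ H_0^{\mathrm{path}}(\vec C_n^S;\mathbb K)\cong\mathbb K,\qquad H_1^{\mathrm{path}}(\vec C_n^S;\mathbb K)\cong\mathbb K,\qquad H_m^{\mathrm{path}}(\vec C_n^S;\mathbb K)=0\quad\text{for all } m\ge 2 . \] -/

import Mathlib

noncomputable section

namespace PathHomology

variable (K V : Type*) [Field K]

/-- `Λ_m(V; K)`: the vector space with basis the elementary `m`-paths `e_{v_0 ... v_m}`. -/
abbrev Chains (m : ℕ) : Type _ := (Fin (m + 1) → V) →₀ K

/-- The boundary `∂ e_{v_0 ... v_{m+1}} = ∑_j (-1)^j e_{v_0 ... (omit v_j) ... v_{m+1}}`. -/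
def chainBoundary (m : ℕ) : Chains K V (m + 1) →ₗ[K] Chains K V m :=
  Finsupp.linearCombination K fun v : Fin (m + 2) → V =>
    ∑ j : Fin (m + 2), Finsupp.single (fun i => v (j.succAbove i)) ((-1 : K) ^ (j : ℕ))

/-- `I_m(V; K)`: the span of the irregular elementary paths (two consecutive equal vertices). -/
def irregular (m : ℕ) : Submodule K (Chains K V m) :=
  Submodule.span K
    {x | ∃ v : Fin (m + 1) → V, (∃ k : Fin m, v k.castSucc = v k.succ) ∧ x = Finsupp.single v 1}

/-- `R_m(V; K) = Λ_m / I_m`: the regular paths. -/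
abbrev Regular (m : ℕ) : Type _ := Chains K V m ⧸ irregular K V m

variable {K V} in
theorem chainBoundary_single (m : ℕ) (v : Fin (m + 2) → V) :
    chainBoundary K V m (Finsupp.single v 1) =
      ∑ j : Fin (m + 2), Finsupp.single (fun i => v (j.succAbove i)) ((-1 : K) ^ (j : ℕ)) := by
  simp [chainBoundary]

/-- The boundary maps irregular chains to irregular chains, so it descends to `R_*`. -/
theorem irregular_le_comap (m : ℕ) :
    irregular K V (m + 1) ≤ (irregular K V m).comap (chainBoundary K V m) := by
  refine Submodule.span_le.2 ?_
  rintro _ ⟨v, ⟨k, hk⟩, rfl⟩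
  rw [SetLike.mem_coe, Submodule.mem_comap, chainBoundary_single]
  have hne : k.castSucc ≠ k.succ := Fin.castSucc_lt_succ.ne
  rw [← Finset.add_sum_erase _ _ (Finset.mem_univ k.castSucc),
    ← Finset.add_sum_erase _ _ (Finset.mem_erase.2 ⟨hne.symm, Finset.mem_univ k.succ⟩), ← add_assoc]
  refine Submodule.add_mem _ ?_ (Submodule.sum_mem _ ?_)
  · have hface : (fun i => v (k.castSucc.succAbove i)) = fun i => v (k.succ.succAbove i) := by
      funext i
      rcases lt_trichotomy i k with h | h | h
      · rw [Fin.succAbove_of_castSucc_lt _ _ (by simpa using h),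
          Fin.succAbove_of_castSucc_lt _ _ (by rw [Fin.lt_def] at h ⊢; simp; omega)]
      · subst h
        rw [Fin.succAbove_castSucc_self, Fin.succAbove_succ_self, hk]
      · rw [Fin.succAbove_of_le_castSucc _ _ (by simpa using h.le),
          Fin.succAbove_of_le_castSucc _ _ (by rw [Fin.lt_def] at h; rw [Fin.le_def]; simp; omega)]
    rw [hface, ← Finsupp.single_add]
    simp [pow_succ]
  · intro j hj
    simp only [Finset.mem_erase, Finset.mem_univ, and_true] at hj
    obtain ⟨h1, h2⟩ := hj
    rw [← mul_one ((-1 : K) ^ (j : ℕ)), ← smul_eq_mul, ← Finsupp.smul_single]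
    refine Submodule.smul_mem _ _ (Submodule.subset_span ⟨_, ?_, rfl⟩)
    have h1' : (j : ℕ) ≠ k := fun h => h2 (Fin.ext (by simpa using h))
    have h2' : (j : ℕ) ≠ k + 1 := fun h => h1 (Fin.ext (by simpa using h))
    rcases lt_or_gt_of_ne h1' with h | h
    · have hk0 : (k : ℕ) - 1 < m := by omega
      refine ⟨⟨k - 1, hk0⟩, ?_⟩
      have e1 : j.succAbove (Fin.castSucc ⟨(k : ℕ) - 1, hk0⟩) = k.castSucc := by
        rw [Fin.succAbove_of_le_castSucc _ _ (by simp [Fin.le_def]; omega)]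
        ext; simp; omega
      have e2 : j.succAbove (Fin.succ ⟨(k : ℕ) - 1, hk0⟩) = k.succ := by
        rw [Fin.succAbove_of_le_castSucc _ _ (by simp [Fin.le_def]; omega)]
        ext; simp; omega
      simp only [e1, e2, hk]
    · have hk0 : (k : ℕ) < m := by omega
      refine ⟨⟨k, hk0⟩, ?_⟩
      have e1 : j.succAbove (Fin.castSucc ⟨(k : ℕ), hk0⟩) = k.castSucc := by
        rw [Fin.succAbove_of_castSucc_lt _ _ (by simp [Fin.lt_def]; omega)]
        ext; simp
      have e2 : j.succAbove (Fin.succ ⟨(k : ℕ), hk0⟩) = k.succ := by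
        rw [Fin.succAbove_of_castSucc_lt _ _ (by simp [Fin.lt_def]; omega)]
        ext; simp
      simp only [e1, e2, hk]

/-- The induced boundary `∂ : R_{m+1} → R_m`. -/
def boundary (m : ℕ) : Regular K V (m + 1) →ₗ[K] Regular K V m :=
  (irregular K V (m + 1)).mapQ (irregular K V m) (chainBoundary K V m) (irregular_le_comap K V m)

theorem chainBoundary_comp (m : ℕ) (x : Chains K V (m + 2)) :
    chainBoundary K V m (chainBoundary K V (m + 1) x) = 0 := by
  suffices h : chainBoundary K V m ∘ₗ chainBoundary K V (m + 1) = 0 from LinearMap.congr_fun h x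
  refine Finsupp.lhom_ext' fun v => LinearMap.ext_ring ?_
  simp only [LinearMap.comp_apply, Finsupp.lsingle_apply, chainBoundary_single, map_sum,
    LinearMap.zero_apply]
  have key : ∀ j : Fin (m + 3), chainBoundary K V m
      (Finsupp.single (fun i => v (j.succAbove i)) ((-1 : K) ^ (j : ℕ))) =
      ∑ l : Fin (m + 2), Finsupp.single (fun i => v (j.succAbove (l.succAbove i)))
        ((-1 : K) ^ ((j : ℕ) + l)) := by
    intro j
    rw [← mul_one ((-1 : K) ^ (j : ℕ)), ← smul_eq_mul, ← Finsupp.smul_single, map_smul,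
      chainBoundary_single, Finset.smul_sum]
    simp [pow_add]
  simp only [key]
  rw [← Finset.sum_product']
  refine Finset.sum_involution
    (fun p _ => (p.1.succAbove p.2, p.2.predAbove p.1)) ?_ ?_ ?_ ?_
  · rintro ⟨j, l⟩ -
    simp only [Fin.succAbove_succAbove_succAbove_predAbove,
      Fin.neg_one_pow_succAbove_add_predAbove]
    rw [← Finsupp.single_add]
    simp
  · rintro ⟨j, l⟩ - - h
    exact Fin.succAbove_ne j l (congrArg Prod.fst h)
  · simp
  · rintro ⟨j, l⟩ -
    simp [Fin.succAbove_succAbove_predAbove, Fin.predAbove_predAbove_succAbove]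

theorem boundary_comp (m : ℕ) (x : Regular K V (m + 2)) :
    boundary K V m (boundary K V (m + 1) x) = 0 := by
  obtain ⟨x, rfl⟩ := Submodule.Quotient.mk_surjective _ x
  simp [boundary, chainBoundary_comp]

variable {V}

/-- `A_m(G; K) ⊆ R_m`: the span of the elementary paths that follow edges of `G`. -/
def allowed (G : Digraph V) (m : ℕ) : Submodule K (Regular K V m) :=
  Submodule.span K
    {x | ∃ v : Fin (m + 1) → V, (∀ k : Fin m, G.Adj (v k.castSucc) (v k.succ)) ∧
      x = (irregular K V m).mkQ (Finsupp.single v 1)}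

/-- The GLMY space `Ω_m(G; K)` of `∂`-invariant allowed paths:
`Ω_0 = A_0`, `Ω_1 = A_1` and `Ω_m = {u ∈ A_m | ∂u ∈ A_{m-1}}` for `m ≥ 2`. -/
def Omega (G : Digraph V) : (m : ℕ) → Submodule K (Regular K V m)
  | 0 => allowed K G 0
  | 1 => allowed K G 1
  | m + 2 => allowed K G (m + 2) ⊓ (allowed K G (m + 1)).comap (boundary K V (m + 1))

/-- The `m`-cycles of the complex `Ω_*(G; K)`; in degree `0` the boundary is zero. -/
def cycles (G : Digraph V) : (m : ℕ) → Submodule K (Regular K V m)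
  | 0 => Omega K G 0
  | m + 1 => Omega K G (m + 1) ⊓ LinearMap.ker (boundary K V m)

/-- The `m`-boundaries `∂ Ω_{m+1}(G; K)`. -/
def boundaries (G : Digraph V) (m : ℕ) : Submodule K (Regular K V m) :=
  (Omega K G (m + 1)).map (boundary K V m)

theorem allowed_zero (G : Digraph V) : allowed K G 0 = ⊤ := by
  refine eq_top_iff.2 fun x _ => ?_
  obtain ⟨x, rfl⟩ := (irregular K V 0).mkQ_surjective x
  induction x using Finsupp.induction_linear with
  | zero => simp
  | add f g hf hg => rw [map_add]; exact Submodule.add_mem _ (hf trivial) (hg trivial)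
  | single v c =>
    rw [← mul_one c, ← smul_eq_mul, ← Finsupp.smul_single, map_smul]
    exact Submodule.smul_mem _ _ (Submodule.subset_span ⟨v, fun k => k.elim0, rfl⟩)

/-- `Ω_*(G; K)` is a chain complex: `∂ Ω_{m+1} ⊆ Ω_m`. -/
theorem boundary_mem_Omega (G : Digraph V) (m : ℕ) {x : Regular K V (m + 1)}
    (hx : x ∈ Omega K G (m + 1)) : boundary K V m x ∈ Omega K G m := by
  match m, x, hx with
  | 0, x, _ => simp [Omega, allowed_zero]
  | 1, x, hx => exact hx.2
  | m + 2, x, hx => exact ⟨hx.2, by simp [boundary_comp]⟩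

/-- Every boundary is a cycle. -/
theorem boundaries_le_cycles (G : Digraph V) (m : ℕ) : boundaries K G m ≤ cycles K G m := by
  rintro _ ⟨x, hx, rfl⟩
  match m, x, hx with
  | 0, x, hx => exact boundary_mem_Omega K G 0 hx
  | m + 1, x, hx => exact ⟨boundary_mem_Omega K G (m + 1) hx, boundary_comp K V m x⟩

/-- The path homology `H_m(G; K)`: cycles modulo boundaries of `Ω_*(G; K)`. -/
abbrev Homology (G : Digraph V) (m : ℕ) : Type _ :=
  cycles K G m ⧸ (boundaries K G m).submoduleOf (cycles K G m)

end PathHomology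

/-- The circulant digraph on `ℤ/n` with connection set `S`: arrows `a → a + s` for `s ∈ S`. -/
def circulantDigraph (n : ℕ) (S : Set (ZMod n)) : Digraph (ZMod n) where
  Adj a b := ∃ s ∈ S, b = a + s

/-- The connection set `{1, 2, ..., d}` in `ℤ/n`. -/
def initialSteps (n d : ℕ) : Set (ZMod n) := (fun k : ℕ => (k : ZMod n)) '' Set.Icc 1 d

end

/-! Every arrow can be broken into unit steps, so the digraph should behave like a directed cycle.
Since `2 * d < n`, two consecutive arrows never wrap around: lengths add, and there are no loops or
directed 2-cycles. Faces of allowed words are therefore regular, and `Ω` can be computed with honest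
chains instead of classes modulo irregular ones (`IsOriented.Omega_eq_map`).

In degree at least two, let `h` (`unitHomotopy`) split a unit step off the first arrow of a word, or
give `0` if that arrow is already a unit. On allowed words `∂h + h∂ + id` equals a map `shorten`
that keeps words allowed and strictly lowers their total length (`homotopy_single`, `shorten_mem`).
For a cycle `x` this gives `x = shorten x - ∂(h x)`. Here `∂(h x) = shorten x - x` is allowed, so `h
x` lies in `Ω`. Iterating until no length is left shows that `x` bounds (`mem_map_of_cycle`).

In degree one, triangles `a, a + 1, b` reduce each arrow to unit steps, and the only cycles of unit
steps are multiples of the full turn. The turn does not bound: arrow length is additive on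
triangles, hence kills boundaries, while the turn has length `n ≠ 0` in characteristic zero. In
degree zero, unit steps connect all vertices. -/

namespace PathHomology

open Finsupp

/-! ### Chain-level model of path homology for oriented digraphs -/

section Lifting

variable (K : Type*) {V : Type*} [Field K]

/-- The words of length `m + 1` that follow edges of `G`. -/
def allowedWords (G : Digraph V) (m : ℕ) : Set (Fin (m + 1) → V) :=
  {v | ∀ k : Fin m, G.Adj (v k.castSucc) (v k.succ)}

/-- The words without two equal consecutive vertices. -/
def regularWords (V : Type*) (m : ℕ) : Set (Fin (m + 1) → V) :=
  {v | ∀ k : Fin m, v k.castSucc ≠ v k.succ}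

theorem irregular_eq_supported (m : ℕ) :
    irregular K V m = supported K K (regularWords V m)ᶜ := by
  rw [irregular, supported_eq_span_single]
  congr 1
  ext x
  simp only [regularWords, Set.mem_ofPred_eq, Set.mem_image, Set.mem_compl_iff, not_forall, not_not]
  exact ⟨fun ⟨v, h, e⟩ => ⟨v, h, e.symm⟩, fun ⟨v, h, e⟩ => ⟨v, h, e.symm⟩⟩

theorem allowed_eq_map (G : Digraph V) (m : ℕ) :
    allowed K G m = (supported K K (allowedWords G m)).map (irregular K V m).mkQ := by
  rw [allowed, supported_eq_span_single, Submodule.map_span, Set.image_image]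
  congr 1
  ext x
  simp only [allowedWords, Set.mem_ofPred_eq, Set.mem_image]
  exact ⟨fun ⟨v, h, e⟩ => ⟨v, h, e.symm⟩, fun ⟨v, h, e⟩ => ⟨v, h, e.symm⟩⟩

variable {K}

/-- The regular words span a complement of the irregular chains, so a class in the quotient has only
one regular representative. -/
theorem eq_zero_of_mem_irregular {m : ℕ} {x : Chains K V m} (hx : x ∈ irregular K V m)
    (hr : x ∈ supported K K (regularWords V m)) : x = 0 := by
  rw [irregular_eq_supported] at hx
  have := (disjoint_supported_supported (M := K) (R := K)
    (disjoint_compl_right (a := regularWords V m)))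
  exact Submodule.disjoint_def.1 this x hr hx

/-- A linear map sends chains supported on `s` into `W` if it does so for the words in `s`. -/
theorem map_mem_of_supported {α M : Type*} [AddCommGroup M] [Module K M] {s : Set α}
    (f : (α →₀ K) →ₗ[K] M) (W : Submodule K M) (h : ∀ v ∈ s, f (single v 1) ∈ W)
    {x : α →₀ K} (hx : x ∈ supported K K s) : f x ∈ W := by
  have : supported K K s ≤ W.comap f := by
    rw [supported_eq_span_single, Submodule.span_le]
    rintro _ ⟨v, hv, rfl⟩
    exact h v hv
  exact this hx

/-- Linear maps that agree on the words in `s` agree on the chains supported on `s`. -/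
theorem eq_of_supported {α M : Type*} [AddCommGroup M] [Module K M] {s : Set α}
    (f g : (α →₀ K) →ₗ[K] M) (h : ∀ v ∈ s, f (single v 1) = g (single v 1))
    {x : α →₀ K} (hx : x ∈ supported K K s) : f x = g x := by
  have := map_mem_of_supported (f - g) ⊥ (fun v hv => by simp [h v hv]) hx
  simpa [sub_eq_zero] using this

theorem boundary_mkQ (m : ℕ) (x : Chains K V (m + 1)) :
    boundary K V m ((irregular K V (m + 1)).mkQ x) =
      (irregular K V m).mkQ (chainBoundary K V m x) := rfl

/-- `G` has no loops and no directed 2-cycles. -/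
def IsOriented (G : Digraph V) : Prop :=
  ∀ a b, G.Adj a b → a ≠ b ∧ ¬ G.Adj b a

variable {G : Digraph V}

theorem IsOriented.allowedWords_subset (hG : IsOriented G) (m : ℕ) :
    allowedWords G m ⊆ regularWords V m :=
  fun _ hv k => (hG _ _ (hv k)).1

/-- Omitting a vertex creates just one new consecutive pair, the two neighbours of that vertex. If
they coincided, the two arrows through the vertex would form a directed 2-cycle. -/
theorem IsOriented.face_mem (hG : IsOriented G) {m : ℕ} {v : Fin (m + 2) → V}
    (hv : v ∈ allowedWords G (m + 1)) (j : Fin (m + 2)) :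
    (fun i => v (j.succAbove i)) ∈ regularWords V m := by
  intro k
  dsimp only
  rcases lt_trichotomy (j : ℕ) (k + 1) with h | h | h
  · rw [Fin.succAbove_of_le_castSucc _ _ (by simp [Fin.le_def]; omega),
      Fin.succAbove_of_le_castSucc _ _ (by simp [Fin.le_def]; omega)]
    exact (hG _ _ (hv k.succ)).1
  · rw [Fin.succAbove_of_castSucc_lt _ _ (by simp [Fin.lt_def]; omega),
      Fin.succAbove_of_le_castSucc _ _ (by simp [Fin.le_def]; omega)]
    intro e
    have h1 := hv k.castSucc
    have h2 := hv k.succ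
    rw [← e] at h2
    exact (hG _ _ h1).2 h2
  · rw [Fin.succAbove_of_castSucc_lt _ _ (by simp [Fin.lt_def]; omega),
      Fin.succAbove_of_castSucc_lt _ _ (by simp [Fin.lt_def]; omega)]
    exact (hG _ _ (hv k.castSucc)).1

theorem IsOriented.chainBoundary_mem (hG : IsOriented G) {m : ℕ} {x : Chains K V (m + 1)}
    (hx : x ∈ supported K K (allowedWords G (m + 1))) :
    chainBoundary K V m x ∈ supported K K (regularWords V m) := by
  refine map_mem_of_supported _ _ (fun v hv => ?_) hx
  rw [chainBoundary_single]
  exact Submodule.sum_mem _ fun j _ => single_mem_supported K _ (hG.face_mem hv j)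

/-- The chain-level model of `Ω_{m+1}`. -/
noncomputable def liftedOmega (K : Type*) [Field K] (G : Digraph V) (m : ℕ) : Submodule K (Chains K V (m + 1)) :=
  supported K K (allowedWords G (m + 1)) ⊓
    (supported K K (allowedWords G m)).comap (chainBoundary K V m)

theorem IsOriented.Omega_eq_map (hG : IsOriented G) (m : ℕ) :
    Omega K G (m + 1) = (liftedOmega K G m).map (irregular K V (m + 1)).mkQ := by
  cases m with
  | zero =>
    rw [Omega, allowed_eq_map, liftedOmega]
    congr 1
    -- Words with a single vertex are always allowed, so the boundary condition is vacuous in degree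
    -- one.
    refine (inf_eq_left.2 fun x _ => ?_).symm
    exact fun v _ k => k.elim0
  | succ m =>
    refine le_antisymm ?_ ?_
    · rintro u ⟨h1, h2⟩
      rw [SetLike.mem_coe, Submodule.mem_comap, allowed_eq_map] at h2
      rw [SetLike.mem_coe, allowed_eq_map] at h1
      obtain ⟨x, hx, rfl⟩ := h1
      obtain ⟨y, hy, hxy⟩ := h2
      refine ⟨x, ⟨hx, ?_⟩, rfl⟩
      -- Both chains are regular and represent the same class, hence they are equal.
      have hxy : chainBoundary K V (m + 1) x - y = 0 := by
        refine eq_zero_of_mem_irregular ?_ (Submodule.sub_mem _ (hG.chainBoundary_mem hx)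
          (supported_mono (hG.allowedWords_subset _) hy))
        rw [boundary_mkQ] at hxy
        exact (Submodule.Quotient.eq _).1 hxy.symm
      rw [SetLike.mem_coe, Submodule.mem_comap, sub_eq_zero.1 hxy]
      exact hy
    · rintro _ ⟨x, ⟨h1, h2⟩, rfl⟩
      refine ⟨?_, ?_⟩
      · rw [SetLike.mem_coe, allowed_eq_map]
        exact ⟨x, h1, rfl⟩
      · rw [SetLike.mem_coe, Submodule.mem_comap, allowed_eq_map]
        exact ⟨_, h2, rfl⟩

theorem IsOriented.cycles_eq_map (hG : IsOriented G) (m : ℕ) :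
    cycles K G (m + 1) = (supported K K (allowedWords G (m + 1)) ⊓
      LinearMap.ker (chainBoundary K V m)).map (irregular K V (m + 1)).mkQ := by
  rw [cycles, hG.Omega_eq_map]
  refine le_antisymm ?_ ?_
  · rintro _ ⟨⟨x, hx, rfl⟩, h⟩
    refine ⟨x, ⟨hx.1, eq_zero_of_mem_irregular ?_ (hG.chainBoundary_mem hx.1)⟩, rfl⟩
    rw [SetLike.mem_coe, LinearMap.mem_ker, boundary_mkQ] at h
    exact (Submodule.Quotient.mk_eq_zero _).1 h
  · rintro _ ⟨x, ⟨h1, h2⟩, rfl⟩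
    have h2 : chainBoundary K V m x = 0 := h2
    refine ⟨⟨x, ⟨h1, ?_⟩, rfl⟩, ?_⟩
    · simp [h2]
    · rw [SetLike.mem_coe, LinearMap.mem_ker, boundary_mkQ, h2, map_zero]

theorem IsOriented.boundaries_eq_map (hG : IsOriented G) (m : ℕ) :
    boundaries K G m = ((liftedOmega K G m).map (chainBoundary K V m)).map
      (irregular K V m).mkQ := by
  rw [boundaries, hG.Omega_eq_map, ← Submodule.map_comp, ← Submodule.map_comp]
  rfl

/-- Homology is one-dimensional if a functional detects it. -/
theorem nonempty_homology_equiv {m : ℕ} (f : Regular K V m →ₗ[K] K)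
    (hb : ∀ x ∈ boundaries K G m, f x = 0) {γ : Regular K V m} (hγ : γ ∈ cycles K G m)
    (hfγ : f γ ≠ 0) (hc : cycles K G m ≤ boundaries K G m ⊔ Submodule.span K {γ}) :
    Nonempty (Homology K G m ≃ₗ[K] K) := by
  let g := f ∘ₗ (cycles K G m).subtype
  have hs : Function.Surjective g := fun c =>
    ⟨(c / f γ) • ⟨γ, hγ⟩, by simp [g, hfγ]⟩
  have hk : (boundaries K G m).submoduleOf (cycles K G m) = LinearMap.ker g := by
    ext ⟨x, hx⟩
    simp only [Submodule.submoduleOf, Submodule.mem_comap, LinearMap.mem_ker, g, LinearMap.comp_apply,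
      Submodule.subtype_apply]
    refine ⟨hb x, fun h => ?_⟩
    obtain ⟨y, hy, z, hz, rfl⟩ := Submodule.mem_sup.1 (hc hx)
    obtain ⟨c, rfl⟩ := Submodule.mem_span_singleton.1 hz
    have : c = 0 := by simpa [hb y hy, hfγ] using h
    simpa [this] using hy
  exact ⟨(Submodule.quotEquivOfEq _ _ hk).trans (g.quotKerEquivOfSurjective hs)⟩

end Lifting

/-! ### The homotopy that inserts a unit step -/

section Insertion

variable (K : Type*) [Field K] {n : ℕ}

/-- `v₀ v₁ ... ↦ v₀ (v₀ + 1) v₁ ...`. -/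
def insertUnit {m : ℕ} (v : Fin (m + 2) → ZMod n) : Fin (m + 3) → ZMod n :=
  Fin.cons (v 0) (Fin.cons (v 0 + 1) (Fin.tail v))

/-- `v₀ v₁ ... ↦ (v₀ + 1) v₁ ...`. -/
def shiftHead {m : ℕ} (v : Fin (m + 2) → ZMod n) : Fin (m + 2) → ZMod n :=
  Fin.cons (v 0 + 1) (Fin.tail v)

open Classical in
/-- The homotopy: split off a unit step at the beginning of a path, if its first step is longer. -/
noncomputable def unitHomotopy (n m : ℕ) :
    Chains K (ZMod n) (m + 1) →ₗ[K] Chains K (ZMod n) (m + 2) :=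
  linearCombination K fun v => if v 1 = v 0 + 1 then 0 else single (insertUnit v) 1

open Classical in
/-- Shorten the first step of a path by one, if it is longer than one. -/
noncomputable def shortenHead (n m : ℕ) :
    Chains K (ZMod n) (m + 1) →ₗ[K] Chains K (ZMod n) (m + 1) :=
  linearCombination K fun v => if v 1 = v 0 + 1 then 0 else single (shiftHead v) 1

/-- The chain map homotopic to the identity that lowers the total length of a path. -/
noncomputable def shorten (n m : ℕ) :
    Chains K (ZMod n) (m + 2) →ₗ[K] Chains K (ZMod n) (m + 2) :=
  shortenHead K n (m + 1) + unitHomotopy K n m ∘ₗ lmapDomain K K Fin.tail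

variable {K}

theorem unitHomotopy_of_eq {m : ℕ} {v : Fin (m + 2) → ZMod n} (h : v 1 = v 0 + 1) (c : K) :
    unitHomotopy K n m (single v c) = 0 := by simp [unitHomotopy, h]

theorem unitHomotopy_of_ne {m : ℕ} {v : Fin (m + 2) → ZMod n} (h : v 1 ≠ v 0 + 1) (c : K) :
    unitHomotopy K n m (single v c) = single (insertUnit v) c := by simp [unitHomotopy, h]

theorem shortenHead_of_eq {m : ℕ} {v : Fin (m + 2) → ZMod n} (h : v 1 = v 0 + 1) (c : K) :
    shortenHead K n m (single v c) = 0 := by simp [shortenHead, h]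

theorem shortenHead_of_ne {m : ℕ} {v : Fin (m + 2) → ZMod n} (h : v 1 ≠ v 0 + 1) (c : K) :
    shortenHead K n m (single v c) = single (shiftHead v) c := by simp [shortenHead, h]

theorem shorten_single {m : ℕ} (v : Fin (m + 3) → ZMod n) :
    shorten K n m (single v 1) =
      shortenHead K n (m + 1) (single v 1) + unitHomotopy K n m (single (Fin.tail v) 1) := by
  simp [shorten]

theorem insertUnit_face_succ_succ {m : ℕ} (v : Fin (m + 3) → ZMod n) (j : Fin (m + 2)) :
    (fun i => insertUnit v (j.succ.succ.succAbove i)) =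
      insertUnit (fun i => v (j.succ.succAbove i)) := by
  funext i
  refine Fin.cases ?_ (fun i => ?_) i
  · simp [insertUnit]
  refine Fin.cases ?_ (fun i => ?_) i
  · simp [insertUnit]
  · simp [insertUnit, Fin.tail]

/-- Omitting `v 0` or the inserted vertex gives the two isolated terms; every later face commutes
with the insertion, at the cost of two index shifts that leave the sign unchanged. -/
theorem chainBoundary_insertUnit {m : ℕ} (v : Fin (m + 3) → ZMod n) :
    chainBoundary K (ZMod n) (m + 2) (single (insertUnit v) 1) =
      single (shiftHead v) 1 - single v 1 + ∑ j : Fin (m + 2),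
        single (insertUnit (fun i => v (j.succ.succAbove i))) ((-1 : K) ^ (j : ℕ)) := by
  rw [chainBoundary_single, Fin.sum_univ_succ, Fin.sum_univ_succ]
  have e0 : (fun i => insertUnit v (Fin.succAbove 0 i)) = shiftHead v := by
    funext i; simp [insertUnit, shiftHead]
  have e1 : (fun i => insertUnit v (Fin.succAbove (Fin.succ 0) i)) = v := by
    funext i
    refine Fin.cases ?_ (fun i => ?_) i
    · simp [insertUnit]
    · simp [insertUnit, Fin.tail]
  rw [e0, e1]
  simp only [insertUnit_face_succ_succ, Fin.val_zero, Fin.val_succ, pow_zero, pow_add, pow_one]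
  simp [sub_eq_add_neg, add_assoc]

/-- The hypothesis `h2` ensures that the face omitting `v 1` starts with a non-unit step, so `h`
does not vanish on it. Faces omitting a later vertex keep the first step of `v`, and the face
omitting `v 0` contributes the tail term of `shorten`. -/
theorem homotopy_single {m : ℕ} (v : Fin (m + 3) → ZMod n) (h2 : v 2 ≠ v 0 + 1) :
    chainBoundary K (ZMod n) (m + 2) (unitHomotopy K n (m + 1) (single v 1)) +
      unitHomotopy K n m (chainBoundary K (ZMod n) (m + 1) (single v 1)) + single v 1 =
      shorten K n m (single v 1) := by
  have tail_eq : (fun i => v (Fin.succAbove 0 i)) = Fin.tail v := by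
    funext i; simp [Fin.tail]
  have face_one : unitHomotopy K n m
      (single (fun i => v ((0 : Fin (m + 2)).succ.succAbove i)) ((-1 : K) ^ 1)) =
      single (insertUnit (fun i => v ((0 : Fin (m + 2)).succ.succAbove i))) (-1) := by
    rw [unitHomotopy_of_ne (by simpa using h2), pow_one]
  rw [shorten_single, chainBoundary_single, map_sum, Fin.sum_univ_succ, tail_eq]
  by_cases h1 : v 1 = v 0 + 1
  · rw [unitHomotopy_of_eq h1, shortenHead_of_eq h1, Fin.sum_univ_succ]
    -- Omitting `v 1` and reinserting a unit step restores `v`; with its sign `-1` this cancels the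
    -- identity term.
    have hv : insertUnit (fun i => v ((0 : Fin (m + 2)).succ.succAbove i)) = v := by
      funext i
      refine Fin.cases ?_ (fun i => ?_) i
      · simp [insertUnit]
      refine Fin.cases ?_ (fun i => ?_) i
      · simp [insertUnit, h1]
      · simp [insertUnit, Fin.tail]
    have rest : ∀ j : Fin (m + 1), unitHomotopy K n m
        (single (fun i => v (j.succ.succ.succAbove i)) ((-1 : K) ^ (j.succ.succ : ℕ))) = 0 :=
      fun j => unitHomotopy_of_eq (by simpa using h1) _
    rw [Finset.sum_eq_zero fun j _ => rest j]
    simp only [Fin.val_succ, Fin.val_zero, zero_add, face_one, hv, map_zero, pow_zero]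
    simp
  · rw [unitHomotopy_of_ne h1, shortenHead_of_ne h1, chainBoundary_insertUnit]
    -- These terms cancel the sum in `chainBoundary_insertUnit`, since omitting an index one higher
    -- flips the sign.
    have rest : ∀ j : Fin (m + 2), unitHomotopy K n m
        (single (fun i => v (j.succ.succAbove i)) ((-1 : K) ^ (j.succ : ℕ))) =
        - single (insertUnit (fun i => v (j.succ.succAbove i))) ((-1 : K) ^ (j : ℕ)) := by
      intro j
      refine Fin.cases ?_ (fun j => ?_) j
      · simpa using face_one
      · rw [unitHomotopy_of_ne (by simpa using h1)]
        simp [pow_succ]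
    simp only [rest, Finset.sum_neg_distrib, Fin.val_zero, pow_zero]
    abel

end Insertion

/-! ### Arrows and lengths in the circulant digraph -/

section Circulant

variable {n d : ℕ}

theorem adj_iff (a b : ZMod n) :
    (circulantDigraph n (initialSteps n d)).Adj a b ↔ ∃ s, 1 ≤ s ∧ s ≤ d ∧ b = a + (s : ℕ) := by
  constructor
  · rintro ⟨_, ⟨s, ⟨h1, h2⟩, rfl⟩, rfl⟩
    exact ⟨s, h1, h2, rfl⟩
  · rintro ⟨s, h1, h2, rfl⟩
    exact ⟨_, ⟨s, ⟨h1, h2⟩, rfl⟩, rfl⟩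

theorem natCast_inj_of_lt {s t : ℕ} (hs : s < n) (ht : t < n) :
    ((s : ZMod n) = t) ↔ s = t := by
  rw [ZMod.natCast_eq_natCast_iff', Nat.mod_eq_of_lt hs, Nat.mod_eq_of_lt ht]

theorem isOriented_circulant (hdn : 2 * d < n) :
    IsOriented (circulantDigraph n (initialSteps n d)) := by
  intro a b h
  obtain ⟨s, h1, h2, rfl⟩ := (adj_iff _ _).1 h
  constructor
  · intro e
    have : ((s : ℕ) : ZMod n) = (0 : ℕ) := by simpa using e.symm
    rw [natCast_inj_of_lt (by omega) (by omega)] at this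
    omega
  · intro h'
    obtain ⟨t, h3, h4, e⟩ := (adj_iff _ _).1 h'
    have : ((s + t : ℕ) : ZMod n) = (0 : ℕ) := by
      push_cast
      linear_combination -e
    rw [natCast_inj_of_lt (by omega) (by omega)] at this
    omega

end Circulant

theorem mem_allowedWords_succ {V : Type*} {G : Digraph V} {m : ℕ} {v : Fin (m + 2) → V} :
    v ∈ allowedWords G (m + 1) ↔ G.Adj (v 0) (v 1) ∧ Fin.tail v ∈ allowedWords G m := by
  simp only [allowedWords, Set.mem_ofPred_eq, Fin.forall_fin_succ (n := m)]
  rfl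

section Circulant

variable {n d : ℕ}

/-- The total length of a path. -/
def weight {m : ℕ} (v : Fin (m + 1) → ZMod n) : ℕ :=
  ∑ k : Fin m, (v k.succ - v k.castSucc).val

theorem weight_succ {m : ℕ} (v : Fin (m + 2) → ZMod n) :
    weight v = (v 1 - v 0).val + weight (Fin.tail v) := by
  simp only [weight, Fin.sum_univ_succ (n := m)]
  rfl

theorem adj_add_one (hd : 1 ≤ d) (a : ZMod n) :
    (circulantDigraph n (initialSteps n d)).Adj a (a + 1) :=
  (adj_iff _ _).2 ⟨1, le_rfl, hd, by simp⟩

/-- An arrow that is not a unit step can be shortened by one. -/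
theorem adj_shorten (hdn : 2 * d < n) {a b : ZMod n}
    (h : (circulantDigraph n (initialSteps n d)).Adj a b) (hb : b ≠ a + 1) :
    (circulantDigraph n (initialSteps n d)).Adj (a + 1) b ∧
      (b - a).val = (b - (a + 1)).val + 1 := by
  obtain ⟨s, h1, h2, rfl⟩ := (adj_iff _ _).1 h
  obtain ⟨t, rfl⟩ := Nat.exists_eq_add_of_le h1
  have ht : t ≠ 0 := by rintro rfl; simp at hb
  refine ⟨(adj_iff _ _).2 ⟨t, by omega, by omega, by push_cast; ring⟩, ?_⟩
  have e1 : a + ((1 + t : ℕ) : ZMod n) - a = ((1 + t : ℕ) : ZMod n) := by ring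
  have e2 : a + ((1 + t : ℕ) : ZMod n) - (a + 1) = (t : ℕ) := by push_cast; ring
  rw [e1, e2, ZMod.val_natCast_of_lt (by omega), ZMod.val_natCast_of_lt (by omega), add_comm]

theorem val_sub_pos_of_adj (hdn : 2 * d < n) {a b : ZMod n}
    (h : (circulantDigraph n (initialSteps n d)).Adj a b) : 0 < (b - a).val := by
  obtain ⟨s, h1, h2, rfl⟩ := (adj_iff _ _).1 h
  rw [add_sub_cancel_left, ZMod.val_natCast_of_lt (by omega)]
  omega

/-- Two arrows have total length at most `2 * d < n`, so no reduction modulo `n` takes place. -/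
theorem val_sub_add_val_sub (hdn : 2 * d < n) {a b c : ZMod n}
    (h : (circulantDigraph n (initialSteps n d)).Adj a b)
    (h' : (circulantDigraph n (initialSteps n d)).Adj b c) :
    (c - a).val = (b - a).val + (c - b).val := by
  obtain ⟨s, h1, h2, rfl⟩ := (adj_iff _ _).1 h
  obtain ⟨t, h3, h4, rfl⟩ := (adj_iff _ _).1 h'
  have e : a + (s : ZMod n) + t - a = ((s + t : ℕ) : ZMod n) := by push_cast; ring
  rw [e, add_sub_cancel_left, add_sub_cancel_left, ZMod.val_natCast_of_lt (by omega),
    ZMod.val_natCast_of_lt (by omega), ZMod.val_natCast_of_lt (by omega)]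

theorem val_add_one_sub (hn : 1 < n) (a : ZMod n) : (a + 1 - a).val = 1 := by
  rw [add_sub_cancel_left, ZMod.val_one'' (by omega)]

theorem ne_add_one_of_adj_adj (hdn : 2 * d < n) {a b c : ZMod n}
    (h : (circulantDigraph n (initialSteps n d)).Adj a b)
    (h' : (circulantDigraph n (initialSteps n d)).Adj b c) : c ≠ a + 1 := by
  rintro rfl
  have := val_sub_add_val_sub hdn h h'
  have h1 := val_sub_pos_of_adj hdn h
  have h2 := val_sub_pos_of_adj hdn h'
  have hn : 1 < n := by
    obtain ⟨s, h1, h2, -⟩ := (adj_iff _ _).1 h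
    omega
  rw [val_add_one_sub hn] at this
  omega

section Words

variable {m : ℕ} {v : Fin (m + 2) → ZMod n}

theorem shiftHead_mem (hdn : 2 * d < n)
    (hv : v ∈ allowedWords (circulantDigraph n (initialSteps n d)) (m + 1))
    (h : v 1 ≠ v 0 + 1) :
    shiftHead v ∈ allowedWords (circulantDigraph n (initialSteps n d)) (m + 1) ∧
      weight (shiftHead v) + 1 = weight v := by
  obtain ⟨h1, h2⟩ := mem_allowedWords_succ.1 hv
  obtain ⟨h3, h4⟩ := adj_shorten hdn h1 h
  constructor
  · exact mem_allowedWords_succ.2 ⟨h3, h2⟩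
  · rw [weight_succ, weight_succ v, h4]
    change (v 1 - (v 0 + 1)).val + weight (Fin.tail v) + 1 = _
    omega

theorem insertUnit_mem (hd : 1 ≤ d) (hdn : 2 * d < n)
    (hv : v ∈ allowedWords (circulantDigraph n (initialSteps n d)) (m + 1))
    (h : v 1 ≠ v 0 + 1) :
    insertUnit v ∈ allowedWords (circulantDigraph n (initialSteps n d)) (m + 2) ∧
      weight (insertUnit v) = weight v := by
  obtain ⟨h1, h2⟩ := mem_allowedWords_succ.1 hv
  obtain ⟨h3, h4⟩ := adj_shorten hdn h1 h
  constructor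
  · exact mem_allowedWords_succ.2 ⟨adj_add_one hd _, mem_allowedWords_succ.2 ⟨h3, h2⟩⟩
  · rw [weight_succ, ← (shiftHead_mem hdn hv h).2, add_comm]
    exact congrArg (_ + ·) (val_add_one_sub (n := n) (by omega) (v 0))

end Words

variable {K : Type*} [Field K]

theorem unitHomotopy_mem (hd : 1 ≤ d) (hdn : 2 * d < n) {m : ℕ} {x : Chains K (ZMod n) (m + 1)}
    (hx : x ∈ supported K K (allowedWords (circulantDigraph n (initialSteps n d)) (m + 1))) :
    unitHomotopy K n m x ∈
      supported K K (allowedWords (circulantDigraph n (initialSteps n d)) (m + 2)) := by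
  refine map_mem_of_supported _ _ (fun v hv => ?_) hx
  by_cases h : v 1 = v 0 + 1
  · simp [unitHomotopy_of_eq h]
  · rw [unitHomotopy_of_ne h]
    exact single_mem_supported K _ (insertUnit_mem hd hdn hv h).1

theorem shorten_mem (hd : 1 ≤ d) (hdn : 2 * d < n) {m N : ℕ} {x : Chains K (ZMod n) (m + 2)}
    (hx : x ∈ supported K K (allowedWords (circulantDigraph n (initialSteps n d)) (m + 2) ∩
      {v | weight v < N + 1})) :
    shorten K n m x ∈ supported K K
      (allowedWords (circulantDigraph n (initialSteps n d)) (m + 2) ∩ {v | weight v < N}) := by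
  refine map_mem_of_supported _ _ (fun v hv => ?_) hx
  obtain ⟨hv, hN⟩ := hv
  have hN : weight v < N + 1 := hN
  rw [shorten_single]
  refine Submodule.add_mem _ ?_ ?_
  · by_cases h : v 1 = v 0 + 1
    · simp [shortenHead_of_eq h]
    · rw [shortenHead_of_ne h]
      obtain ⟨h1, h2⟩ := shiftHead_mem hdn hv h
      exact single_mem_supported K _ ⟨h1, show weight _ < N by omega⟩
  -- Insertion preserves length, so this term loses the positive length of the dropped first arrow.
  · obtain ⟨h0, ht⟩ := mem_allowedWords_succ.1 hv
    have hw := weight_succ v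
    have hp := val_sub_pos_of_adj hdn h0
    by_cases h : Fin.tail v 1 = Fin.tail v 0 + 1
    · simp [unitHomotopy_of_eq h]
    · rw [unitHomotopy_of_ne h]
      obtain ⟨h1, h2⟩ := insertUnit_mem hd hdn ht h
      exact single_mem_supported K _ ⟨h1, show weight _ < N by omega⟩

theorem homotopy_of_supported (hdn : 2 * d < n) {m : ℕ} {x : Chains K (ZMod n) (m + 2)}
    (hx : x ∈ supported K K (allowedWords (circulantDigraph n (initialSteps n d)) (m + 2))) :
    chainBoundary K (ZMod n) (m + 2) (unitHomotopy K n (m + 1) x) +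
      unitHomotopy K n m (chainBoundary K (ZMod n) (m + 1) x) + x = shorten K n m x := by
  refine eq_of_supported (chainBoundary K (ZMod n) (m + 2) ∘ₗ unitHomotopy K n (m + 1) +
    unitHomotopy K n m ∘ₗ chainBoundary K (ZMod n) (m + 1) + LinearMap.id) (shorten K n m)
    (fun v hv => ?_) hx
  exact homotopy_single v (ne_add_one_of_adj_adj hdn (hv 0) (hv 1))

/-- Allowed cycles of degree at least two bound. -/
theorem mem_map_of_cycle (hd : 1 ≤ d) (hdn : 2 * d < n) {m : ℕ} (N : ℕ) :
    ∀ {x : Chains K (ZMod n) (m + 2)},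
    x ∈ supported K K (allowedWords (circulantDigraph n (initialSteps n d)) (m + 2) ∩
      {v | weight v < N}) → chainBoundary K (ZMod n) (m + 1) x = 0 →
    x ∈ (liftedOmega K (circulantDigraph n (initialSteps n d)) (m + 2)).map
      (chainBoundary K (ZMod n) (m + 2)) := by
  induction N with
  | zero =>
    intro x hx _
    have : x = 0 := by
      rw [mem_supported] at hx
      refine support_eq_empty.1 (Finset.eq_empty_of_forall_notMem fun v hv => ?_)
      exact Nat.not_lt_zero _ (hx hv).2
    rw [this]
    exact Submodule.zero_mem _
  | succ N ih =>
    intro x hx hc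
    have hxa := supported_mono Set.inter_subset_left hx
    have key := homotopy_of_supported hdn hxa
    rw [hc, map_zero, add_zero] at key
    have hs := shorten_mem hd hdn hx
    have hsc : chainBoundary K (ZMod n) (m + 1) (shorten K n m x) = 0 := by
      rw [← key, map_add, chainBoundary_comp, hc, add_zero]
    -- The boundary of `h x` is `shorten x - x`, a difference of allowed chains.
    have hb : unitHomotopy K n (m + 1) x ∈
        liftedOmega K (circulantDigraph n (initialSteps n d)) (m + 2) := by
      refine ⟨unitHomotopy_mem hd hdn hxa, ?_⟩
      rw [SetLike.mem_coe, Submodule.mem_comap, eq_sub_of_add_eq key]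
      exact Submodule.sub_mem _ (supported_mono Set.inter_subset_left hs) hxa
    rw [eq_sub_of_add_eq' key]
    exact Submodule.sub_mem _ (ih hs hsc) (Submodule.mem_map_of_mem hb)

theorem cycles_le_boundaries (hd : 1 ≤ d) (hdn : 2 * d < n) (m : ℕ) :
    cycles K (circulantDigraph n (initialSteps n d)) (m + 2) ≤
      boundaries K (circulantDigraph n (initialSteps n d)) (m + 2) := by
  have hG := isOriented_circulant hdn
  rw [hG.cycles_eq_map, hG.boundaries_eq_map]
  refine Submodule.map_mono fun x ⟨hx, hc⟩ => ?_
  refine mem_map_of_cycle hd hdn (x.support.sup weight + 1) ?_ hc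
  exact fun v hv => ⟨hx hv, Nat.lt_succ_of_le (Finset.le_sup (f := weight) hv)⟩

end Circulant

/-! ### Boundaries and detecting functionals in degrees zero and one -/

section LowDegree

variable {K V : Type*} [Field K]

theorem chainBoundary_two (a b : V) :
    chainBoundary K V 0 (single ![a, b] 1) = single ![b] 1 - single ![a] 1 := by
  rw [chainBoundary_single, Fin.sum_univ_two]
  have e0 : (fun i => ![a, b] (Fin.succAbove 0 i)) = ![b] := by
    funext i; fin_cases i; rfl
  have e1 : (fun i => ![a, b] (Fin.succAbove 1 i)) = ![a] := by
    funext i; fin_cases i; rfl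
  rw [e0, e1]
  simp [sub_eq_add_neg]

theorem chainBoundary_three (a b c : V) :
    chainBoundary K V 1 (single ![a, b, c] 1) =
      single ![b, c] 1 - single ![a, c] 1 + single ![a, b] 1 := by
  rw [chainBoundary_single, Fin.sum_univ_three]
  have e0 : (fun i => ![a, b, c] (Fin.succAbove 0 i)) = ![b, c] := by
    funext i; fin_cases i <;> rfl
  have e1 : (fun i => ![a, b, c] (Fin.succAbove 1 i)) = ![a, c] := by
    funext i; fin_cases i <;> rfl
  have e2 : (fun i => ![a, b, c] (Fin.succAbove 2 i)) = ![a, b] := by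
    funext i; fin_cases i <;> rfl
  rw [e0, e1, e2]
  simp [sub_eq_add_neg]

theorem pair_mem_allowedWords {G : Digraph V} {a b : V} :
    ![a, b] ∈ allowedWords G 1 ↔ G.Adj a b := by
  simp [allowedWords]

theorem triple_mem_allowedWords {G : Digraph V} {a b c : V} :
    ![a, b, c] ∈ allowedWords G 2 ↔ G.Adj a b ∧ G.Adj b c := by
  simp [allowedWords, Fin.forall_fin_two]

theorem mem_allowedWords_zero {G : Digraph V} (v : Fin 1 → V) : v ∈ allowedWords G 0 :=
  fun k => k.elim0

variable (K V) in
/-- The augmentation `R_0 → K`. -/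
noncomputable def augmentation : Regular K V 0 →ₗ[K] K :=
  (irregular K V 0).liftQ (linearCombination K fun _ => 1) <| by
    rw [irregular, Submodule.span_le]
    rintro _ ⟨v, ⟨k, -⟩, -⟩
    exact k.elim0

theorem augmentation_mkQ_single (v : Fin 1 → V) (c : K) :
    augmentation K V ((irregular K V 0).mkQ (single v c)) = c := by
  simp [augmentation]

theorem augmentation_boundary (x : Regular K V 1) :
    augmentation K V (boundary K V 0 x) = 0 := by
  obtain ⟨x, rfl⟩ := (irregular K V 1).mkQ_surjective x
  rw [boundary_mkQ]
  refine LinearMap.congr_fun (f := augmentation K V ∘ₗ (irregular K V 0).mkQ ∘ₗ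
    chainBoundary K V 0) (g := 0) (Finsupp.lhom_ext' fun v => LinearMap.ext_ring ?_) x
  rw [LinearMap.comp_apply, LinearMap.comp_apply, LinearMap.comp_apply, lsingle_apply,
    chainBoundary_single, map_sum, map_sum, Fin.sum_univ_two, augmentation_mkQ_single,
    augmentation_mkQ_single]
  simp

variable (K) in
/-- The functional on `R_1` that measures the length of an arrow of `ℤ/n`. -/
noncomputable def arrowLength (n : ℕ) : Regular K (ZMod n) 1 →ₗ[K] K :=
  (irregular K (ZMod n) 1).liftQ (linearCombination K fun v => ((v 1 - v 0).val : K)) <| by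
    rw [irregular, Submodule.span_le]
    rintro _ ⟨v, ⟨k, hk⟩, rfl⟩
    obtain rfl : k = 0 := Subsingleton.elim _ _
    have hk : v 0 = v 1 := hk
    simp [hk]

theorem arrowLength_mkQ_single {n : ℕ} (a b : ZMod n) :
    arrowLength K n ((irregular K (ZMod n) 1).mkQ (single ![a, b] 1)) = ((b - a).val : K) := by
  simp [arrowLength]

end LowDegree

/-! ### Homology in degrees zero and one -/

section Circulant

variable {n d : ℕ} {K : Type*} [Field K]

theorem homology_zero (hd : 1 ≤ d) (hdn : 2 * d < n) :
    Nonempty (Homology K (circulantDigraph n (initialSteps n d)) 0 ≃ₗ[K] K) := by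
  have : NeZero n := ⟨by omega⟩
  have hG := isOriented_circulant hdn
  refine nonempty_homology_equiv (augmentation K (ZMod n)) ?_
    (γ := (irregular K (ZMod n) 0).mkQ (single ![0] 1)) ?_ ?_ ?_
  · rintro _ ⟨x, -, rfl⟩
    exact augmentation_boundary x
  · rw [cycles, Omega, allowed_zero]
    trivial
  · rw [augmentation_mkQ_single]
    exact one_ne_zero
  · rw [cycles, Omega, allowed_eq_map, hG.boundaries_eq_map, ← Set.image_singleton,
      ← Submodule.map_span, ← Submodule.map_sup]
    refine Submodule.map_mono fun x hx => ?_
    refine map_mem_of_supported LinearMap.id _ (fun v _ => ?_) hx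
    obtain ⟨k, hk⟩ := ZMod.natCast_zmod_surjective (v 0)
    obtain rfl : v = ![(k : ZMod n)] := by
      funext i; fin_cases i; exact hk.symm
    clear hk
    rw [LinearMap.id_apply]
    induction k with
    | zero =>
      rw [Nat.cast_zero]
      exact Submodule.mem_sup_right (Submodule.mem_span_singleton_self _)
    | succ k ih =>
      -- The unit arrow from `k` to `k + 1` makes consecutive vertices homologous.
      have h := chainBoundary_two (K := K) (k : ZMod n) (k + 1)
      rw [Nat.cast_succ, eq_add_of_sub_eq h.symm]
      refine Submodule.add_mem _ (Submodule.mem_sup_left (Submodule.mem_map_of_mem ⟨?_, ?_⟩))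
        (ih (mem_allowedWords_zero _))
      · exact single_mem_supported K _ (pair_mem_allowedWords.2 (adj_add_one hd _))
      · exact fun v _ => mem_allowedWords_zero v

/-- Every allowed 1-chain is a combination of unit steps up to a boundary. -/
theorem supported_le_boundaries_sup (hd : 1 ≤ d) :
    supported K K (allowedWords (circulantDigraph n (initialSteps n d)) 1) ≤
      (liftedOmega K (circulantDigraph n (initialSteps n d)) 1).map (chainBoundary K (ZMod n) 1) ⊔
        supported K K (Set.range fun a : ZMod n => ![a, a + 1]) := by
  intro x hx
  refine map_mem_of_supported LinearMap.id _ (fun v hv => ?_) hx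
  have hv' : v = ![v 0, v 1] := by
    funext i; fin_cases i <;> rfl
  rw [LinearMap.id_apply]
  rw [hv'] at hv ⊢
  obtain ⟨s, h1, h2, e⟩ := (adj_iff _ _).1 (pair_mem_allowedWords.1 hv)
  rw [e]
  generalize v 0 = a
  clear e hv hv'
  induction s, h1 using Nat.le_induction generalizing a with
  | base =>
    rw [Nat.cast_one]
    exact Submodule.mem_sup_right (single_mem_supported K _ ⟨a, rfl⟩)
  | succ s h1 ih =>
    -- All three edges of this triangle are arrows, so it lies in `Ω`; it trades an arrow of length
    -- `s + 1` for a unit step and an arrow of length `s`.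
    have h := chainBoundary_three (K := K) a (a + 1) (a + 1 + s)
    have e : a + ((s + 1 : ℕ) : ZMod n) = a + 1 + s := by push_cast; ring
    have h' : single ![a, a + 1 + (s : ZMod n)] (1 : K) = single ![a + 1, a + 1 + (s : ZMod n)] 1
        + single ![a, a + 1] 1 -
        chainBoundary K (ZMod n) 1 (single ![a, a + 1, a + 1 + (s : ZMod n)] 1) := by
      rw [h]; abel
    have a1 : (circulantDigraph n (initialSteps n d)).Adj (a + 1) (a + 1 + s) :=
      (adj_iff _ _).2 ⟨s, h1, by omega, rfl⟩
    have a2 : (circulantDigraph n (initialSteps n d)).Adj a (a + 1 + s) :=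
      (adj_iff _ _).2 ⟨s + 1, by omega, h2, e.symm⟩
    rw [e, h']
    refine Submodule.sub_mem _ (Submodule.add_mem _ (ih (by omega) _) ?_)
      (Submodule.mem_sup_left (Submodule.mem_map_of_mem ⟨?_, ?_⟩))
    · exact Submodule.mem_sup_right (single_mem_supported K _ ⟨a, rfl⟩)
    · exact single_mem_supported K _ (triple_mem_allowedWords.2 ⟨adj_add_one hd _, a1⟩)
    · rw [SetLike.mem_coe, Submodule.mem_comap, h]
      refine Submodule.add_mem _ (Submodule.sub_mem _ ?_ ?_) ?_ <;>
        refine single_mem_supported K _ (pair_mem_allowedWords.2 ?_)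
      exacts [a1, a2, adj_add_one hd _]

/-- The cycles among the combinations of unit steps are the multiples of the full turn. -/
theorem mem_span_of_unit_cycle [NeZero n] {t : Chains K (ZMod n) 1}
    (ht : t ∈ supported K K (Set.range fun a : ZMod n => ![a, a + 1]))
    (hc : chainBoundary K (ZMod n) 0 t = 0) :
    t ∈ Submodule.span K {∑ a : ZMod n, single ![a, a + 1] (1 : K)} := by
  classical
  have expand : t = ∑ a : ZMod n, t ![a, a + 1] • single ![a, a + 1] (1 : K) := by
    have := eq_of_supported LinearMap.id (∑ a : ZMod n,
      (lapply ![a, a + 1]).smulRight (single ![a, a + 1] (1 : K))) (fun v hv => ?_) ht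
    · simpa using this
    · obtain ⟨b, rfl⟩ := hv
      simp only [LinearMap.id_apply, LinearMap.sum_apply, LinearMap.smulRight_apply, lapply_apply]
      rw [Finset.sum_eq_single b]
      · simp
      · intro a _ hab
        rw [single_eq_of_ne fun h => hab (congrFun h 0), zero_smul]
      · simp
  -- The coefficient of the vertex `b + 1` in the boundary is the difference of the coefficients of
  -- the incoming and outgoing unit steps.
  have step : ∀ b : ZMod n, t ![b + 1, b + 1 + 1] = t ![b, b + 1] := by
    intro b
    rw [expand] at hc
    simp only [map_sum, map_smul, chainBoundary_two] at hc
    have := DFunLike.congr_fun hc ![b + 1]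
    simp [single_apply, mul_sub, Finset.sum_sub_distrib] at this
    exact (sub_eq_zero.1 this).symm
  have const : ∀ b : ZMod n, t ![b, b + 1] = t ![0, 0 + 1] := by
    intro b
    obtain ⟨k, rfl⟩ := ZMod.natCast_zmod_surjective b
    induction k with
    | zero => rw [Nat.cast_zero]
    | succ k ih => rw [Nat.cast_succ, step, ih]
  simp only [const] at expand
  rw [expand, ← Finset.smul_sum]
  exact Submodule.smul_mem _ _ (Submodule.mem_span_singleton_self _)

theorem homology_one [CharZero K] (hd : 1 ≤ d) (hdn : 2 * d < n) :
    Nonempty (Homology K (circulantDigraph n (initialSteps n d)) 1 ≃ₗ[K] K) := by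
  have : NeZero n := ⟨by omega⟩
  have hG := isOriented_circulant hdn
  have hγ : (∑ a : ZMod n, single ![a, a + 1] (1 : K)) ∈
      supported K K (allowedWords (circulantDigraph n (initialSteps n d)) 1) ⊓
        LinearMap.ker (chainBoundary K (ZMod n) 0) := by
    refine ⟨Submodule.sum_mem _ fun a _ => single_mem_supported K _
      (pair_mem_allowedWords.2 (adj_add_one hd a)), ?_⟩
    rw [SetLike.mem_coe, LinearMap.mem_ker, map_sum]
    simp only [chainBoundary_two]
    rw [Finset.sum_sub_distrib, sub_eq_zero]
    exact Equiv.sum_comp (Equiv.addRight (1 : ZMod n)) fun a => single ![a] (1 : K)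
  refine nonempty_homology_equiv (arrowLength K n) ?_
    (γ := (irregular K (ZMod n) 1).mkQ (∑ a : ZMod n, single ![a, a + 1] 1)) ?_ ?_ ?_
  · rw [hG.boundaries_eq_map]
    rintro _ ⟨_, ⟨x, ⟨hx, -⟩, rfl⟩, rfl⟩
    -- Length is additive along any two consecutive arrows, so the functional kills the boundary of
    -- every allowed 2-word, and not only those of elements of `Ω`.
    refine eq_of_supported (arrowLength K n ∘ₗ (irregular K (ZMod n) 1).mkQ ∘ₗ
      chainBoundary K (ZMod n) 1) 0 (fun v hv => ?_) hx
    have hv' : v = ![v 0, v 1, v 2] := by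
      funext i; fin_cases i <;> rfl
    have h := val_sub_add_val_sub hdn (hv 0) (hv 1)
    change (v 2 - v 0).val = (v 1 - v 0).val + (v 2 - v 1).val at h
    rw [hv', LinearMap.comp_apply, LinearMap.comp_apply, chainBoundary_three, map_add, map_sub,
      map_add, map_sub, arrowLength_mkQ_single, arrowLength_mkQ_single, arrowLength_mkQ_single, h]
    push_cast
    simp
  · rw [hG.cycles_eq_map]
    exact ⟨_, hγ, rfl⟩
  -- The full turn consists of `n` steps of length one, and `n` is nonzero in characteristic zero.
  · rw [map_sum, map_sum, Finset.sum_congr rfl fun a _ => by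
      rw [arrowLength_mkQ_single, val_add_one_sub (by omega)]]
    simp [NeZero.ne n]
  · rw [hG.cycles_eq_map, hG.boundaries_eq_map, ← Set.image_singleton,
      ← Submodule.map_span, ← Submodule.map_sup]
    refine Submodule.map_mono fun x ⟨hx, hc⟩ => ?_
    obtain ⟨y, hy, t, ht, rfl⟩ := Submodule.mem_sup.1 (supported_le_boundaries_sup hd hx)
    -- Removing the boundary `y` from the cycle leaves a cycle `t` of unit steps.
    refine Submodule.add_mem_sup hy (mem_span_of_unit_cycle ht ?_)
    obtain ⟨z, -, rfl⟩ := hy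
    rwa [SetLike.mem_coe, LinearMap.mem_ker, map_add, chainBoundary_comp, zero_add] at hc

end Circulant

end PathHomology

theorem mainTheorem4 (K : Type*) [Field K] [CharZero K] (n d : ℕ) (hd : 2 < d) (hdn : 2 * d < n) :
    Nonempty (PathHomology.Homology K (circulantDigraph n (initialSteps n d)) 0 ≃ₗ[K] K) ∧
    Nonempty (PathHomology.Homology K (circulantDigraph n (initialSteps n d)) 1 ≃ₗ[K] K) ∧
    ∀ m : ℕ, 2 ≤ m →
      Subsingleton (PathHomology.Homology K (circulantDigraph n (initialSteps n d)) m) := by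
  have hd' : 1 ≤ d := by omega
  refine ⟨PathHomology.homology_zero hd' hdn, PathHomology.homology_one hd' hdn, fun m hm => ?_⟩
  obtain ⟨m, rfl⟩ := Nat.exists_eq_add_of_le' hm
  rw [Submodule.Quotient.subsingleton_iff, Submodule.submoduleOf,
    Submodule.comap_subtype_eq_top]
  exact PathHomology.cycles_le_boundaries hd' hdn m
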